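/- Let $\mathfrak O$ be a compact discrete valuation ring with maximal ideal $\mathfrak P$ and residue field of size $q$, and write $\mathfrak O_n = \mathfrak O/\mathfrak P^n$. A module representation over a commutative ring $R$ is an $R$-linear map $\theta\colon M \to \operatorname{Hom}_R(V,W)$, where $M,V,W$ are $R$-modules; for a ring homomorphism $R\to S$, let $\theta^S\colon M\otimes_R S \to \operatorname{Hom}_S(V\otimes_R S, W\otimes_R S)$ denote its change of scalars. For a module representation $\theta$ over $\mathfrak O$ with $M,V,W$ finitely generated and an integer $m \ge 0$, the $\mathrm{ask}^m$ zeta function of $\theta$ is $$\mathsf Z^m_\theta(T) = \sum_{n=0}^\infty \mathrm{ask}^m(\theta^{\mathfrak O_n})\, T^n \in \mathbf Q[\![T]\!],$$ where $\mathrm{ask}^m(\theta) = \frac 1{|M|}\sum_{a\in M} |\operatorname{Ker}(a\theta)|^m$ for a module representation $\theta$ with $M$ and $V$ finite. For $d \ge 0$, define $c_d(X_1,\dotsc,X_d) \in \operatorname{Mat}_{\binom{d+1}2\times d}(\mathbf Z[X_1,\dotsc,X_d])$ recursively: $c_0$ is the $0\times 0$ matrix and, for $d \geq 1$, $$c_d(X_1,\dotsc,X_d)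 = \begin{bmatrix} X_1 1_d \\ \begin{array}{c|c} 0_{\binom d2\times 1} & c_{d-1}(X_2,\dotsc,X_d)\end{array}\end{bmatrix}.$$ Let $\gamma_d\colon \mathbf Z^d \to \operatorname{Mat}_{\binom{d+1}2\times d}(\mathbf Z) = \operatorname{Hom}(\mathbf Z^{\binom{d+1}2},\mathbf Z^d)$, $x\gamma_d = c_d(x)$, where matrices act on row vectors from the right, and let $\theta_d = \gamma_d^{\mathfrak O}$. Then, for all integers $d \ge 0$ and $m\ge 0$, $$\mathsf Z^m_{\theta_d}(T) = \frac 1{1-q^{m\binom{d+1}2-d}T}\cdot\prod_{j=0}^{d-1}\frac{1-q^{m\binom d2+(m-1)j-1}T}{1-q^{m\binom d2+(m-1)j}T}.$$ -/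

import Mathlib

open scoped TensorProduct

noncomputable section

namespace AskZeta

/-- Change of scalars of a module representation `θ : M → Hom(V, W)` over `R` along `R → S`:
the module representation `S ⊗ M → Hom(S ⊗ V, S ⊗ W)` over `S` with
`(s ⊗ a) ↦ (t ⊗ x ↦ (s * t) ⊗ (x (a θ)))`. -/
def changeScalars {R : Type*} (S : Type*) [CommRing R] [CommRing S] [Algebra R S]
    {M V W : Type*} [AddCommGroup M] [AddCommGroup V] [AddCommGroup W]
    [Module R M] [Module R V] [Module R W] (θ : M →ₗ[R] V →ₗ[R] W) :
    (S ⊗[R] M) →ₗ[S] (S ⊗[R] V) →ₗ[S] (S ⊗[R] W) :=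
  LinearMap.liftBaseChange S (LinearMap.baseChangeHom R S V W ∘ₗ θ)

/-- `(1 / |M|) * ∑_{a ∈ M} |Ker (a θ)| ^ m` for a module representation `θ : M → Hom(V, W)`
whose modules `M` and `V` are finite as sets (`∑ᶠ` is then the ordinary sum over `M`). -/
def askm {R : Type*} [CommRing R]
    {M V W : Type*} [AddCommGroup M] [AddCommGroup V] [AddCommGroup W]
    [Module R M] [Module R V] [Module R W] (θ : M →ₗ[R] V →ₗ[R] W) (m : ℕ) : ℚ :=
  (Nat.card M : ℚ)⁻¹ * ∑ᶠ a : M, (Nat.card (LinearMap.ker (θ a)) : ℚ) ^ m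

/-- The ask`^m` zeta function `∑_{n ≥ 0} askm (θ^{𝔒/𝔓^n}) m * T ^ n` of a module representation
of finitely generated modules over a compact discrete valuation ring `𝔒` with
maximal ideal `𝔓`. -/
def askmZeta {O : Type*} [CommRing O] [IsLocalRing O]
    {M V W : Type*} [AddCommGroup M] [AddCommGroup V] [AddCommGroup W]
    [Module O M] [Module O V] [Module O W] (θ : M →ₗ[O] V →ₗ[O] W) (m : ℕ) : PowerSeries ℚ :=
  PowerSeries.mk fun n => askm (changeScalars (O ⧸ IsLocalRing.maximalIdeal O ^ n) θ) m

/-- Splitting `(d+2).choose 2 = (d+1) + (d+1).choose 2` rows into the first `d+1` rows and the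
remaining ones, in order. -/
def rowEquiv (d : ℕ) :
    Fin ((d + 1 + 1).choose 2) ≃ Fin (d + 1) ⊕ Fin ((d + 1).choose 2) :=
  (finCongr (by rw [Nat.choose_succ_succ' (d + 1) 1, Nat.choose_one_right])).trans
    finSumFinEquiv.symm

/-- The matrix `c_d(x_1, …, x_d)` of size `(d+1).choose 2 × d`: its first `d` rows are
`x_1 1_d`, below these is the block matrix `[0 | c_{d-1}(x_2, …, x_d)]` whose first
column is zero. -/
def cMat {R : Type*} [CommRing R] :
    (d : ℕ) → (Fin d → R) → Matrix (Fin ((d + 1).choose 2)) (Fin d) R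
  | 0, _ => 0
  | d + 1, x =>
    (Matrix.fromRows (x 0 • (1 : Matrix (Fin (d + 1)) (Fin (d + 1)) R))
      (Matrix.of fun i j => (Fin.cons 0 (cMat d (Fin.tail x) i) : Fin (d + 1) → R) j)).submatrix
        (rowEquiv d) id

theorem cMat_add {R : Type*} [CommRing R] (d : ℕ) (x y : Fin d → R) :
    cMat d (x + y) = cMat d x + cMat d y := by
  induction d with
  | zero => simp [cMat]
  | succ d ih =>
    have ht : Fin.tail (x + y) = Fin.tail x + Fin.tail y := rfl
    ext i j
    simp only [cMat, ht, ih, Matrix.submatrix_apply, Matrix.add_apply, id]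
    rcases rowEquiv d i with k | k
    · simp [add_mul]
    · refine Fin.cases ?_ (fun l => ?_) j <;> simp

theorem cMat_smul {R : Type*} [CommRing R] (d : ℕ) (r : R) (x : Fin d → R) :
    cMat d (r • x) = r • cMat d x := by
  induction d with
  | zero => simp [cMat]
  | succ d ih =>
    have ht : Fin.tail (r • x) = r • Fin.tail x := rfl
    ext i j
    simp only [cMat, ht, ih, Matrix.submatrix_apply, Matrix.smul_apply, id]
    rcases rowEquiv d i with k | k
    · simp [mul_assoc]
    · refine Fin.cases ?_ (fun l => ?_) j <;> simp

/-- The module representation `γ_d : ℤ^d → Hom(ℤ^{(d+1).choose 2}, ℤ^d)`, `x γ_d = c_d(x)`, where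
matrices act on row vectors from the right. -/
def gamma (d : ℕ) : (Fin d → ℤ) →ₗ[ℤ] (Fin ((d + 1).choose 2) → ℤ) →ₗ[ℤ] (Fin d → ℤ) where
  toFun x := (cMat d x).vecMulLinear
  map_add' x y := by
    refine LinearMap.ext fun v => ?_
    simp [cMat_add]
  map_smul' r x := by
    refine LinearMap.ext fun v => ?_
    rw [cMat_smul]
    simp

end AskZeta

end

/-!
Over a finite ring `R`, the image of `c_d(x)` is `∏ⱼ Jⱼ` with `Jⱼ = (x₁, …, xⱼ)`, so its kernel has
`|R| ^ (d.choose 2) * ∏ⱼ |R / Jⱼ|` elements. Take `R = 𝔒 / 𝔓ⁿ`. Adding a uniformly random principal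
ideal to `𝔓ᵏ` gives `𝔓ⁱ` with probability `q⁻ⁱ(1 - q⁻¹)` for `i < k` and `𝔓ᵏ` with probability
`q⁻ᵏ`. Hence the mean of `∏ⱼ |R / (𝔓ᵏ + Jⱼ)| ^ m` satisfies a recursion in `d`, which on generating
functions in `k` reads `F_{d+1}(T) = F_d(q ^ (m - 1) T) * (1 - q⁻¹ T) / (1 - T)`.
-/

namespace AskZeta

section ChangeOfScalars

variable {R : Type*} [CommRing R] {M V W : Type*} [AddCommGroup M] [AddCommGroup V]
  [AddCommGroup W] [Module R M] [Module R V] [Module R W]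

theorem askm_congr {R' : Type*} [CommRing R'] {M' V' W' : Type*} [AddCommGroup M']
    [AddCommGroup V'] [AddCommGroup W'] [Module R' M'] [Module R' V'] [Module R' W']
    {θ : M →ₗ[R] V →ₗ[R] W} {θ' : M' →ₗ[R'] V' →ₗ[R'] W'} (e : M ≃ M') (f : V ≃ V') (g : W ≃+ W')
    (h : ∀ a v, g (θ a v) = θ' (e a) (f v)) (m : ℕ) : askm θ m = askm θ' m := by
  rw [askm, askm, Nat.card_congr e]
  congr 1
  refine finsum_eq_of_bijective e e.bijective fun a => ?_
  have hker (v : V) : v ∈ LinearMap.ker (θ a) ↔ f v ∈ LinearMap.ker (θ' (e a)) := by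
    rw [LinearMap.mem_ker, LinearMap.mem_ker, ← h, map_eq_zero_iff g g.injective]
  rw [Nat.card_congr (f.subtypeEquiv hker)]

variable {S : Type*} [CommRing S] [Algebra R S] (θ : M →ₗ[R] V →ₗ[R] W)

theorem changeScalars_tmul (s t : S) (a : M) (v : V) :
    changeScalars S θ (s ⊗ₜ a) (t ⊗ₜ v) = (s * t) ⊗ₜ θ a v := by
  simp [changeScalars, TensorProduct.smul_tmul']

open TensorProduct.AlgebraTensorModule in
theorem cancelBaseChange_changeScalars (T : Type*) [CommRing T] [Algebra R T] [Algebra S T]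
    [IsScalarTower R S T] (a : T ⊗[S] (S ⊗[R] M)) (v : T ⊗[S] (S ⊗[R] V)) :
    cancelBaseChange R S T T W (changeScalars T (changeScalars S θ) a v) =
      changeScalars T θ (cancelBaseChange R S T T M a) (cancelBaseChange R S T T V v) := by
  suffices h : (changeScalars T (changeScalars S θ)).compr₂ (cancelBaseChange R S T T W).toLinearMap
      = (changeScalars T θ).compl₁₂ (cancelBaseChange R S T T M).toLinearMap
          (cancelBaseChange R S T T V).toLinearMap from LinearMap.congr_fun₂ h a v
  ext a v
  simp [changeScalars_tmul]

open TensorProduct.AlgebraTensorModule in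
theorem askm_changeScalars_changeScalars (T : Type*) [CommRing T] [Algebra R T] [Algebra S T]
    [IsScalarTower R S T] (m : ℕ) :
    askm (changeScalars T (changeScalars S θ)) m = askm (changeScalars T θ) m :=
  askm_congr (cancelBaseChange R S T T M).toEquiv (cancelBaseChange R S T T V).toEquiv
    (cancelBaseChange R S T T W).toAddEquiv (cancelBaseChange_changeScalars θ T) m

/-- The module representation `Rᵈ → Hom(R ^ ((d+1).choose 2), Rᵈ)`, `x ↦ c_d(x)`, of which
`gamma d` is the case `R = ℤ`. -/
def gammaOver (R : Type*) [CommRing R] (d : ℕ) :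
    (Fin d → R) →ₗ[R] (Fin ((d + 1).choose 2) → R) →ₗ[R] (Fin d → R) where
  toFun x := (cMat d x).vecMulLinear
  map_add' x y := by
    ext
    simp [cMat_add]
  map_smul' r x := by
    ext
    simp [cMat_smul]

theorem gamma_eq_gammaOver (d : ℕ) : gamma d = gammaOver ℤ d := rfl

theorem cMat_map {R S : Type*} [CommRing R] [CommRing S] (f : R →+* S) (d : ℕ)
    (x : Fin d → R) : cMat d (f ∘ x) = (cMat d x).map f := by
  induction d with
  | zero => ext i j; exact j.elim0
  | succ d ih =>
    have ht : Fin.tail (f ∘ x) = f ∘ Fin.tail x := rfl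
    ext i j
    simp only [cMat, ht, ih, Matrix.submatrix_apply, Matrix.map_apply, id]
    rcases rowEquiv d i with k | k
    · simp [Matrix.one_apply, apply_ite f]
    · refine Fin.cases ?_ (fun l => ?_) j <;> simp

theorem gammaOver_comp {R S : Type*} [CommRing R] [CommRing S] (f : R →+* S) {d : ℕ}
    (x : Fin d → R) (v : Fin ((d + 1).choose 2) → R) :
    gammaOver S d (f ∘ x) (f ∘ v) = f ∘ gammaOver R d x v := by
  ext j
  change Matrix.vecMul (f ∘ v) (cMat d (f ∘ x)) j = f (Matrix.vecMul v (cMat d x) j)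
  rw [cMat_map, RingHom.map_vecMul]

open TensorProduct in
theorem piScalarRight_changeScalars_gamma (S : Type*) [CommRing S] (d : ℕ)
    (a : S ⊗[ℤ] (Fin d → ℤ)) (v : S ⊗[ℤ] (Fin ((d + 1).choose 2) → ℤ)) :
    piScalarRight ℤ S S (Fin d) (changeScalars S (gamma d) a v) =
      gammaOver S d (piScalarRight ℤ S S _ a) (piScalarRight ℤ S S _ v) := by
  suffices h : (changeScalars S (gamma d)).compr₂ (piScalarRight ℤ S S (Fin d)).toLinearMap =
      (gammaOver S d).compl₁₂ (piScalarRight ℤ S S _).toLinearMap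
        (piScalarRight ℤ S S _).toLinearMap from LinearMap.congr_fun₂ h a v
  ext i j k
  simpa [changeScalars_tmul, gamma_eq_gammaOver, Function.comp_def] using congrFun
    (gammaOver_comp (Int.castRingHom S) (Pi.single i 1) (Pi.single j 1)).symm k

theorem askm_changeScalars_gamma (S : Type*) [CommRing S] (d m : ℕ) :
    askm (changeScalars S (gamma d)) m = askm (gammaOver S d) m :=
  askm_congr (TensorProduct.piScalarRight ℤ S S _).toEquiv
    (TensorProduct.piScalarRight ℤ S S _).toEquiv
    (TensorProduct.piScalarRight ℤ S S _).toAddEquiv (piScalarRight_changeScalars_gamma S d) m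

theorem askm_changeScalars_changeScalars_gamma (R S : Type*) [CommRing R] [CommRing S] [Algebra R S]
    (d m : ℕ) :
    askm (changeScalars S (changeScalars R (gamma d))) m = askm (gammaOver S d) m :=
  (askm_changeScalars_changeScalars _ S m).trans (askm_changeScalars_gamma S d m)

end ChangeOfScalars

section Kernel

theorem image_Iic_zero {α : Type*} {d : ℕ} (x : Fin (d + 1) → α) : x '' Set.Iic 0 = {x 0} := by
  ext y; simp [eq_comm, Set.mem_image]

theorem image_Iic_succ {α : Type*} {d : ℕ} (x : Fin (d + 1) → α) (j : Fin d) :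
    x '' Set.Iic j.succ = insert (x 0) (Fin.tail x '' Set.Iic j) := by
  ext y
  simp only [Set.mem_image, Set.mem_Iic, Set.mem_insert_iff, Fin.exists_fin_succ, Fin.zero_le,
    true_and, Fin.succ_le_succ_iff, Fin.tail]
  tauto

variable {R : Type*} [CommRing R]

theorem gammaOver_succ_apply (d : ℕ) (x : Fin (d + 1) → R) (v : Fin ((d + 1 + 1).choose 2) → R) :
    gammaOver R (d + 1) x v =
      x 0 • (v ∘ (rowEquiv d).symm ∘ Sum.inl) +
        Fin.cons 0 (gammaOver R d (Fin.tail x) (v ∘ (rowEquiv d).symm ∘ Sum.inr)) := by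
  change Matrix.vecMul v (cMat (d + 1) x) = _
  rw [cMat, Matrix.submatrix_vecMul_equiv, Matrix.vecMul_fromRows, Matrix.vecMul_smul,
    Matrix.vecMul_one]
  ext j
  refine Fin.cases ?_ (fun l => ?_) j <;>
    simp [gammaOver, Matrix.vecMul, dotProduct, Function.comp_def]

theorem card_ker_mul_card {V W : Type*} [AddCommGroup V] [AddCommGroup W] [Module R V] [Module R W]
    (f : V →ₗ[R] W) : Nat.card (LinearMap.ker f) * Nat.card W =
      Nat.card V * Nat.card (W ⧸ LinearMap.range f) := by
  rw [Submodule.card_eq_card_quotient_mul_card (LinearMap.range f),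
    Submodule.card_eq_card_quotient_mul_card (LinearMap.ker f),
    Nat.card_congr f.quotKerEquivRange.toEquiv]
  ring

theorem range_gammaOver {d : ℕ} (x : Fin d → R) :
    LinearMap.range (gammaOver R d x) =
      Submodule.pi Set.univ fun j => Ideal.span (x '' Set.Iic j) := by
  ext w
  rw [Submodule.mem_pi]
  simp only [Set.mem_univ, true_imp_iff]
  induction d with
  | zero => exact ⟨fun _ j => j.elim0, fun _ => ⟨0, Subsingleton.elim _ _⟩⟩
  | succ d ih =>
    constructor
    · rintro ⟨v, rfl⟩ j
      rw [gammaOver_succ_apply]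
      refine Fin.cases ?_ (fun j => ?_) j
      · simpa [image_Iic_zero] using Ideal.mul_mem_right _ _ (Ideal.mem_span_singleton_self (x 0))
      · rw [image_Iic_succ]
        refine Ideal.add_mem _ ?_ ?_
        · exact Ideal.mul_mem_right _ _ (Ideal.subset_span (Set.mem_insert _ _))
        · exact Ideal.span_mono (Set.subset_insert _ _) ((ih _ _).1 ⟨_, rfl⟩ j)
    · intro hw
      simp only [Fin.forall_fin_succ, image_Iic_zero, image_Iic_succ, Ideal.mem_span_singleton',
        Ideal.mem_span_insert] at hw
      obtain ⟨⟨a₀, ha₀⟩, htail⟩ := hw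
      choose a b hb hab using htail
      obtain ⟨u, hu⟩ := (ih (Fin.tail x) b).2 hb
      refine ⟨Sum.elim (Fin.cons a₀ a : Fin (d + 1) → R) u ∘ rowEquiv d, ?_⟩
      rw [gammaOver_succ_apply]
      ext j
      refine Fin.cases ?_ (fun j => ?_) j
      · simp [← ha₀, mul_comm]
      · simp [hab, ← hu, mul_comm, Function.comp_def]

theorem card_ker_gammaOver [Finite R] {d : ℕ} (x : Fin d → R) :
    Nat.card (LinearMap.ker (gammaOver R d x)) =
      Nat.card R ^ d.choose 2 * ∏ j, Nat.card (R ⧸ Ideal.span (x '' Set.Iic j)) := by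
  have hcoker : Nat.card ((Fin d → R) ⧸ LinearMap.range (gammaOver R d x)) =
      ∏ j, Nat.card (R ⧸ Ideal.span (x '' Set.Iic j)) := by
    rw [range_gammaOver, Nat.card_congr (Submodule.quotientPi _).toEquiv, Nat.card_pi]
  have hR : 0 < Nat.card R ^ d := pow_pos Nat.card_pos d
  have h := card_ker_mul_card (gammaOver R d x)
  rw [hcoker, Nat.card_fun, Nat.card_fun, Nat.card_fin, Nat.card_fin] at h
  refine Nat.eq_of_mul_eq_mul_right hR (h.trans ?_)
  rw [Nat.choose_succ_succ' d 1, Nat.choose_one_right]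
  ring

theorem card_div_card [Finite R] (I : Ideal R) :
    (Nat.card I : ℚ) / Nat.card R = (Nat.card (R ⧸ I) : ℚ)⁻¹ := by
  have hI : (Nat.card I : ℚ) ≠ 0 := by exact_mod_cast Nat.card_pos.ne'
  rw [Submodule.card_eq_card_quotient_mul_card I, Nat.cast_mul, div_mul_cancel_left₀ hI]

end Kernel

section Mean

open scoped BigOperators

theorem askm_eq_expect {R M V W : Type*} [CommRing R] [AddCommGroup M] [AddCommGroup V]
    [AddCommGroup W] [Module R M] [Module R V] [Module R W] [Fintype M] (θ : M →ₗ[R] V →ₗ[R] W)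
    (m : ℕ) : askm θ m = 𝔼 a, (Nat.card (LinearMap.ker (θ a)) : ℚ) ^ m := by
  rw [askm, finsum_eq_sum_of_fintype, Fintype.expect_eq_sum_div_card, Nat.card_eq_fintype_card,
    div_eq_inv_mul]

variable {R : Type*} [CommRing R] [Fintype R]

/-- The mean over `x ∈ Rᵈ` of the products `∏ⱼ |R / (I + (x₁, …, xⱼ))| ^ m`. The ideal `I`
accumulates the coordinates already chosen when the mean is computed one coordinate at a time. -/
noncomputable def meanIndexProd (m d : ℕ) (I : Ideal R) : ℚ :=
  𝔼 x : Fin d → R, ∏ j, (Nat.card (R ⧸ I ⊔ Ideal.span (x '' Set.Iic j)) : ℚ) ^ m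

theorem askm_gammaOver (d m : ℕ) :
    askm (gammaOver R d) m =
      ((Nat.card R : ℚ) ^ d.choose 2) ^ m * meanIndexProd m d (⊥ : Ideal R) := by
  simp only [askm_eq_expect, meanIndexProd, card_ker_gammaOver, Finset.mul_expect, bot_sup_eq,
    Nat.cast_mul, Nat.cast_pow, Nat.cast_prod, mul_pow, Finset.prod_pow]

theorem meanIndexProd_zero (m : ℕ) (I : Ideal R) : meanIndexProd m 0 I = 1 := by
  simp [meanIndexProd]

theorem meanIndexProd_succ (m d : ℕ) (I : Ideal R) :
    meanIndexProd m (d + 1) I = 𝔼 a, (Nat.card (R ⧸ I ⊔ Ideal.span {a}) : ℚ) ^ m *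
      meanIndexProd m d (I ⊔ Ideal.span {a}) := by
  rw [meanIndexProd, ← Fintype.expect_equiv (Fin.consEquiv fun _ => R) _ _ fun _ => rfl,
    ← Finset.univ_product_univ, Finset.expect_product]
  simp only [meanIndexProd, Finset.mul_expect, Fin.prod_univ_succ, image_Iic_zero, image_Iic_succ,
    Fin.consEquiv_apply, Fin.cons_zero, Fin.tail_cons, Ideal.span_insert, ← sup_assoc]

theorem sum_eq_sum_add_sum_sdiff {α M : Type*} [DecidableEq α] [AddCommMonoid M]
    {F : ℕ → Finset α} (hF : Antitone F) (f : α → M) (k : ℕ) :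
    ∑ x ∈ F 0, f x = ∑ x ∈ F k, f x + ∑ i ∈ Finset.range k, ∑ x ∈ F i \ F (i + 1), f x := by
  induction k with
  | zero => simp
  | succ k ih =>
    rw [ih, ← Finset.sum_sdiff (hF k.le_succ), Finset.sum_range_succ]
    abel

theorem expect_sup_span_singleton {I : ℕ → Ideal R} (hI : Antitone I) (hI₀ : I 0 = ⊤)
    (hspan : ∀ i, ∀ x ∈ I i, x ∉ I (i + 1) → Ideal.span {x} = I i) (g : Ideal R → ℚ) (k : ℕ) :
    𝔼 x, g (I k ⊔ Ideal.span {x}) = (Nat.card (R ⧸ I k) : ℚ)⁻¹ * g (I k) +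
      ∑ i ∈ Finset.range k,
        ((Nat.card (R ⧸ I i) : ℚ)⁻¹ - (Nat.card (R ⧸ I (i + 1)) : ℚ)⁻¹) * g (I i) := by
  classical
  let F (i : ℕ) : Finset R := {x | x ∈ I i}
  have mem_F {i : ℕ} {x : R} : x ∈ F i ↔ x ∈ I i := Finset.mem_filter_univ x
  have card_F (i : ℕ) : ((F i).card : ℚ) = Nat.card (I i) := by
    rw [Nat.card_eq_fintype_card, Fintype.card_subtype]
  have hF : Antitone F := fun i j hij x hx => mem_F.2 (hI hij (mem_F.1 hx))
  have hF₀ : F 0 = Finset.univ := by simp [F, hI₀]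
  have hlast : ∑ x ∈ F k, g (I k ⊔ Ideal.span {x}) = Nat.card (I k) * g (I k) := by
    rw [← card_F, ← nsmul_eq_mul]
    refine Finset.sum_eq_card_nsmul fun x hx => ?_
    rw [sup_eq_left.2 ((Ideal.span_singleton_le_iff_mem _).2 (mem_F.1 hx))]
  have hlayer {i : ℕ} (hi : i < k) : ∑ x ∈ F i \ F (i + 1), g (I k ⊔ Ideal.span {x}) =
      ((Nat.card (I i) : ℚ) - Nat.card (I (i + 1))) * g (I i) := by
    rw [← card_F, ← card_F, ← Finset.cast_card_sdiff (hF i.le_succ), ← nsmul_eq_mul]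
    refine Finset.sum_eq_card_nsmul fun x hx => ?_
    rw [Finset.mem_sdiff, mem_F, mem_F] at hx
    rw [hspan i x hx.1 hx.2, sup_eq_right.2 (hI hi.le)]
  rw [Fintype.expect_eq_sum_div_card, ← hF₀, sum_eq_sum_add_sum_sdiff hF _ k, hlast,
    Finset.sum_congr rfl fun i hi => hlayer (Finset.mem_range.1 hi), ← Nat.card_eq_fintype_card,
    add_div, Finset.sum_div, mul_div_right_comm, card_div_card]
  simp only [mul_div_right_comm, sub_div, card_div_card]

end Mean

section GeneratingFunction

open PowerSeries

variable {K : Type*} [Field K]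

/-- The polynomial in `a` and `t` which, for `a = q⁻¹` and `t = q ^ (m - 1)`, is the mean of
`∏ⱼ |R / (𝔓ᵏ + (x₁, …, xⱼ))| ^ m` over `x ∈ Rᵈ` in `R = 𝔒 / 𝔓ⁿ` for `k ≤ n`; the summand with
index `i` accounts for the `x` with `𝔓ᵏ + (x₁) = 𝔓ⁱ`. -/
def chainSum (a t : K) : ℕ → ℕ → K
  | 0, _ => 1
  | d + 1, k => t ^ k * chainSum a t d k +
      (1 - a) * ∑ i ∈ Finset.range k, t ^ i * chainSum a t d i

theorem mk_add_mul_sum_range (a : K) (c : ℕ → K) :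
    PowerSeries.mk (fun k => c k + (1 - a) * ∑ i ∈ Finset.range k, c i) =
      PowerSeries.mk c * ((1 - C a * X) * (1 - C 1 * X)⁻¹) := by
  have coeff_mul_factor (φ : PowerSeries K) (b : K) (n : ℕ) :
      coeff (n + 1) (φ * (1 - C b * X)) = coeff (n + 1) φ - coeff n φ * b := by
    rw [mul_sub, mul_one, map_sub, ← mul_assoc, coeff_succ_mul_X, coeff_mul_C]
  rw [← mul_assoc, PowerSeries.eq_mul_inv_iff_mul_eq (by simp)]
  ext n
  rcases n with _ | n
  · simp
  · simp only [coeff_mul_factor, coeff_mk, Finset.sum_range_succ]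
    ring

theorem rescale_one_sub_C_mul_X (a b : K) :
    rescale a (1 - C b * X) = (1 - C (a * b) * X : PowerSeries K) := by
  rw [map_sub, map_one, ← rescale_X, ← rescale_X, rescale_rescale, mul_comm]

theorem rescale_inv (a : K) (φ : PowerSeries K) : rescale a φ⁻¹ = (rescale a φ)⁻¹ := by
  have h₀ : constantCoeff (rescale a φ) = constantCoeff φ := by
    rw [← coeff_zero_eq_constantCoeff_apply, coeff_rescale, pow_zero, one_mul,
      coeff_zero_eq_constantCoeff_apply]
  by_cases hφ : constantCoeff φ = 0
  · rw [PowerSeries.inv_eq_zero.2 hφ, map_zero, PowerSeries.inv_eq_zero.2 (h₀.trans hφ)]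
  · rw [PowerSeries.eq_inv_iff_mul_eq_one (h₀ ▸ hφ), ← map_mul, PowerSeries.inv_mul_cancel _ hφ,
      map_one]

theorem mk_chainSum (a t : K) (d : ℕ) :
    PowerSeries.mk (chainSum a t d) = (1 - C (t ^ d) * X : PowerSeries K)⁻¹ *
      ∏ j ∈ Finset.range d, ((1 - C (t ^ j * a) * X) * (1 - C (t ^ j) * X)⁻¹) := by
  induction d with
  | zero =>
    rw [Finset.prod_range_zero, mul_one, PowerSeries.eq_inv_iff_mul_eq_one (by simp), pow_zero,
      map_one, one_mul]
    exact mk_one_mul_one_sub_eq_one K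
  | succ d ih =>
    have hrec : PowerSeries.mk (chainSum a t (d + 1)) =
        rescale t (PowerSeries.mk (chainSum a t d)) * ((1 - C a * X) * (1 - C 1 * X)⁻¹) := by
      rw [rescale_mk]
      exact mk_add_mul_sum_range a fun i => t ^ i * chainSum a t d i
    rw [hrec, ih, Finset.prod_range_succ']
    simp only [map_mul (rescale t), map_prod, rescale_inv, rescale_one_sub_C_mul_X, ← mul_assoc,
      ← pow_succ', pow_zero, one_mul]

end GeneratingFunction

section Quotients

open IsLocalRing

section LocalRing

variable {O : Type*} [CommRing O] [IsLocalRing O]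

theorem span_singleton_eq_maximalIdeal_pow (hO : (maximalIdeal O).IsPrincipal) {i : ℕ}
    {x : O} (hx : x ∈ maximalIdeal O ^ i) (hx' : x ∉ maximalIdeal O ^ (i + 1)) :
    Ideal.span {x} = maximalIdeal O ^ i := by
  obtain ⟨π, hπ⟩ := hO
  rw [Ideal.submodule_span_eq] at hπ
  rw [hπ, Ideal.span_singleton_pow, Ideal.mem_span_singleton] at hx hx'
  obtain ⟨z, rfl⟩ := hx
  have hz : IsUnit z := by
    by_contra hz
    rw [← mem_nonunits_iff, ← mem_maximalIdeal, hπ, Ideal.mem_span_singleton] at hz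
    exact hx' (pow_succ π i ▸ mul_dvd_mul_left _ hz)
  rw [hπ, Ideal.span_singleton_pow, Ideal.span_singleton_mul_right_unit hz]

/-- The image of `𝔓ᵏ` in `𝔒 / 𝔓ⁿ`, where `𝔓` is the maximal ideal of `𝔒`. -/
def maximalIdealPowQuotient (O : Type*) [CommRing O] [IsLocalRing O] (n k : ℕ) :
    Ideal (O ⧸ maximalIdeal O ^ n) :=
  (maximalIdeal O ^ k).map (Ideal.Quotient.mk _)

theorem antitone_maximalIdealPowQuotient (n : ℕ) : Antitone (maximalIdealPowQuotient O n) :=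
  fun _ _ h => Ideal.map_mono (Ideal.pow_le_pow_right h)

theorem maximalIdealPowQuotient_zero (n : ℕ) : maximalIdealPowQuotient O n 0 = ⊤ := by
  simp [maximalIdealPowQuotient, Ideal.map_top]

theorem maximalIdealPowQuotient_self (n : ℕ) : maximalIdealPowQuotient O n n = ⊥ :=
  Ideal.map_quotient_self _

theorem span_singleton_eq_maximalIdealPowQuotient (hO : (maximalIdeal O).IsPrincipal) {n i : ℕ}
    {x : O ⧸ maximalIdeal O ^ n} (hx : x ∈ maximalIdealPowQuotient O n i)
    (hx' : x ∉ maximalIdealPowQuotient O n (i + 1)) :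
    Ideal.span {x} = maximalIdealPowQuotient O n i := by
  obtain ⟨y, hy, rfl⟩ := (Ideal.mem_map_iff_of_surjective _ Ideal.Quotient.mk_surjective).1 hx
  rw [maximalIdealPowQuotient, ← span_singleton_eq_maximalIdeal_pow hO hy
    fun hy' => hx' (Ideal.mem_map_of_mem _ hy'), Ideal.map_span, Set.image_singleton]

end LocalRing

variable {O : Type*} [CommRing O] [IsDomain O] [IsDiscreteValuationRing O]

theorem card_quotient_maximalIdeal_pow (n : ℕ) :
    Nat.card (O ⧸ maximalIdeal O ^ n) = Nat.card (ResidueField O) ^ n :=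
  cardQuot_pow_of_prime (IsDiscreteValuationRing.not_a_field O)

theorem card_quotient_maximalIdealPowQuotient {n k : ℕ} (hk : k ≤ n) :
    Nat.card ((O ⧸ maximalIdeal O ^ n) ⧸ maximalIdealPowQuotient O n k) =
      Nat.card (ResidueField O) ^ k := by
  rw [← card_quotient_maximalIdeal_pow]
  exact Nat.card_congr (DoubleQuot.quotQuotEquivQuotOfLE (Ideal.pow_le_pow_right hk)).toEquiv

theorem meanIndexProd_maximalIdealPowQuotient (m d : ℕ) {n k : ℕ}
    [Fintype (O ⧸ maximalIdeal O ^ n)] (hk : k ≤ n) {q : ℚ} (hq : q = Nat.card (ResidueField O)) :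
    meanIndexProd m d (maximalIdealPowQuotient O n k) = chainSum q⁻¹ (q ^ m * q⁻¹) d k := by
  have hcard {i : ℕ} (hi : i ≤ n) : (Nat.card ((O ⧸ maximalIdeal O ^ n) ⧸
      maximalIdealPowQuotient O n i) : ℚ) = q ^ i := by
    rw [card_quotient_maximalIdealPowQuotient hi, hq, Nat.cast_pow]
  have hpow (i : ℕ) : (q ^ m * q⁻¹) ^ i = (q ^ i)⁻¹ * (q ^ i) ^ m := by
    rw [mul_pow, inv_pow, pow_right_comm, mul_comm]
  induction d generalizing k with
  | zero => rw [meanIndexProd_zero, chainSum]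
  | succ d ih =>
    rw [meanIndexProd_succ, expect_sup_span_singleton (antitone_maximalIdealPowQuotient n)
      (maximalIdealPowQuotient_zero n)
      (fun i x => span_singleton_eq_maximalIdealPowQuotient (IsPrincipalIdealRing.principal _))
      (fun I => (Nat.card (_ ⧸ I) : ℚ) ^ m * meanIndexProd m d I), ih hk, hcard hk, chainSum,
      hpow, mul_assoc, Finset.mul_sum]
    congr 1
    refine Finset.sum_congr rfl fun i hi => ?_
    have hin : i < n := (Finset.mem_range.1 hi).trans_le hk
    rw [ih hin.le, hcard hin.le, hcard hin, hpow, pow_succ, mul_inv]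
    ring

theorem askm_changeScalars_quotient (m d n : ℕ) [Finite (ResidueField O)] {q : ℚ}
    (hq : q = Nat.card (ResidueField O)) :
    askm (changeScalars (O ⧸ maximalIdeal O ^ n) (changeScalars O (gamma d))) m =
      (q ^ (m * d.choose 2)) ^ n * chainSum q⁻¹ (q ^ m * q⁻¹) d n := by
  have : Finite (O ⧸ maximalIdeal O) := ‹Finite (ResidueField O)›
  have := Ideal.finite_quotient_pow (IsNoetherian.noetherian (maximalIdeal O)) n
  have := Fintype.ofFinite (O ⧸ maximalIdeal O ^ n)
  rw [askm_changeScalars_changeScalars_gamma, askm_gammaOver,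
    ← maximalIdealPowQuotient_self, meanIndexProd_maximalIdealPowQuotient m d le_rfl hq,
    card_quotient_maximalIdeal_pow, Nat.cast_pow, ← hq]
  ring

theorem finite_quotient_of_isAdic {A : Type*} [CommRing A] [TopologicalSpace A] [CompactSpace A]
    {J : Ideal A} (hJ : IsAdic J) : Finite (A ⧸ J) := by
  have : IsTopologicalRing A := by
    rw [hJ]
    exact J.nonarchimedean.toIsTopologicalRing
  have hopen : IsOpen (J : Set A) := by simpa using (isAdic_iff.1 hJ).1 1
  exact AddSubgroup.quotient_finite_of_isOpen J.toAddSubgroup hopen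

end Quotients

end AskZeta

open PowerSeries IsLocalRing in
theorem lemma6p12_general (O : Type*) [CommRing O] [IsDomain O] [IsDiscreteValuationRing O]
    [Finite (ResidueField O)] (d m : ℕ) (q : ℚ) (hq : q = Nat.card (ResidueField O)) :
    AskZeta.askmZeta (AskZeta.changeScalars O (AskZeta.gamma d)) m =
      (1 - C (q ^ ((m : ℤ) * ((d + 1).choose 2 : ℤ) - (d : ℤ))) * X : PowerSeries ℚ)⁻¹ *
        ∏ j ∈ Finset.range d,
          ((1 - C (q ^ ((m : ℤ) * (d.choose 2 : ℤ) + ((m : ℤ) - 1) * (j : ℤ) - 1)) * X) *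
            (1 - C (q ^ ((m : ℤ) * (d.choose 2 : ℤ) + ((m : ℤ) - 1) * (j : ℤ))) * X)⁻¹) := by
  have hq₀ : q ≠ 0 := by
    rw [hq]
    exact_mod_cast Nat.card_pos.ne'
  have hpow (j : ℕ) : q ^ ((m : ℤ) * (d.choose 2 : ℤ) + ((m : ℤ) - 1) * (j : ℤ)) =
      q ^ (m * d.choose 2) * (q ^ m * q⁻¹) ^ j := by
    rw [zpow_add₀ hq₀, zpow_mul q _ (j : ℤ), zpow_sub_one₀ hq₀]
    exact_mod_cast rfl
  have hexp : (m : ℤ) * ((d + 1).choose 2 : ℤ) - (d : ℤ) =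
      (m : ℤ) * (d.choose 2 : ℤ) + ((m : ℤ) - 1) * (d : ℤ) := by
    rw [Nat.choose_succ_succ' d 1, Nat.choose_one_right]
    push_cast
    ring
  have hzeta : AskZeta.askmZeta (AskZeta.changeScalars O (AskZeta.gamma d)) m =
      rescale (q ^ (m * d.choose 2))
        (PowerSeries.mk (AskZeta.chainSum q⁻¹ (q ^ m * q⁻¹) d)) := by
    simp only [rescale_mk, AskZeta.askmZeta, AskZeta.askm_changeScalars_quotient m d _ hq]
  rw [hzeta, AskZeta.mk_chainSum]
  simp only [map_mul (rescale _), map_prod, AskZeta.rescale_inv, AskZeta.rescale_one_sub_C_mul_X,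
    hexp, zpow_sub_one₀ hq₀, hpow, mul_assoc]

open PowerSeries IsLocalRing in
theorem lemma6p12 (O : Type*) [CommRing O] [IsDomain O] [IsDiscreteValuationRing O]
    [TopologicalSpace O] (hO : IsAdic (maximalIdeal O)) [CompactSpace O]
    (d m : ℕ) (q : ℚ) (hq : q = Nat.card (ResidueField O)) :
    AskZeta.askmZeta (AskZeta.changeScalars O (AskZeta.gamma d)) m =
      (1 - C (q ^ ((m : ℤ) * ((d + 1).choose 2 : ℤ) - (d : ℤ))) * X : PowerSeries ℚ)⁻¹ *
        ∏ j ∈ Finset.range d,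
          ((1 - C (q ^ ((m : ℤ) * (d.choose 2 : ℤ) + ((m : ℤ) - 1) * (j : ℤ) - 1)) * X) *
            (1 - C (q ^ ((m : ℤ) * (d.choose 2 : ℤ) + ((m : ℤ) - 1) * (j : ℤ))) * X)⁻¹) := by
  have : Finite (ResidueField O) := AskZeta.finite_quotient_of_isAdic hO
  exact lemma6p12_general O d m q hq
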